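/- Let $X$ be a real or complex Banach space with a normalised unconditional basis $(x_n)_{n=1}^\infty$ (that is, $\|x_n\|=1$ for all $n$, and every $x\in X$ has a unique expansion $x=\sum_n a_n x_n$, the series converging unconditionally). For $x=\sum_n a_nx_n\in X$ and $N\ge 1$, a greedy approximation is $\mathcal G_N(x)=\sum_{n\in\Lambda}a_nx_n$, where $\Lambda$ is any set of $N$ indices with $\min_{n\in\Lambda}|a_n|\ge\max_{n\notin\Lambda}|a_n|$. Put $$\sigma_N(x)=\inf\Big\{\Big\|x-\sum_{n\in\Lambda}b_nx_n\Big\| : \#\Lambda=N,\ b_n \text{ scalars}\Big\},\qquad \gamma_N(x)=\max\|x-\mathcal G_N(x)\|,$$ the maximum being over all admissible choices of $\mathcal G_N(x)$. For $\alpha>0$ and $0<q<\infty$ let $$\|x\|_{\mathcal A^\alpha_q}=\|x\|+\Big[\sum_{N=1}^\infty (N^\alpha\sigma_N(x))^q\tfrac1N\Big]^{1/q},\qquad \|x\|_{\mathcal A^\alpha_\infty}=\|x\|+\sup_{N\ge1}N^\alpha\sigma_N(x),$$ let $\mathcal A^\alpha_q=\{x\in X:\|x\|_{\mathcal A^\alpha_q}<\infty\}$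 for $0<q\le\infty$, and define $\|x\|_{\mathcal G^\alpha_q}\in[0,\infty]$ in the same way with $\gamma_N$ in place of $\sigma_N$. Then the following are equivalent: 1. $(x_n)$ is democratic: there is a constant $C$ such that $\|\sum_{n\in A}x_n\|\le C\|\sum_{n\in B}x_n\|$ for all finite sets $A,B$ of indices with $\#A=\#B$. 2. $(x_n)$ is greedy: there is a constant $C$ such that $\|x-\mathcal G_N(x)\|\le C\sigma_N(x)$ for all $x\in X$, all $N\ge1$ and every admissible choice of $\mathcal G_N(x)$. 3. For all $\alpha>0$ and $q\in(0,\infty]$ greedy approximation is optimal: there is a constant $C$ (which may depend on $\alpha$ and $q$) such that $\|x\|_{\mathcal G^\alpha_q}\le C\|x\|_{\mathcal A^\alpha_q}$ for all $x\in\mathcal A^\alpha_q$. 4. For some $\alpha>0$ and some $q\in(0,\infty]$ there is a constant $C$ such that $\|x\|_{\mathcal G^\alpha_q}\le C\|x\|_{\mathcal A^\alpha_q}$ for all $x\in\mathcal A^\alpha_q$. -/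

import Mathlib

open scoped ENNReal NNReal

namespace GreedyBasis

noncomputable section

variable {𝕜 X : Type*} [RCLike 𝕜] [NormedAddCommGroup X] [NormedSpace 𝕜 X]

/-- The basis is democratic: `‖∑_{n ∈ A} x_n‖ ≤ C ‖∑_{n ∈ B} x_n‖` for all finite sets of indices
`A`, `B` with the same number of elements. -/
def IsDemocratic (b : UnconditionalSchauderBasis ℕ 𝕜 X) : Prop :=
  ∃ C : ℝ, ∀ A B : Finset ℕ, A.card = B.card → ‖∑ n ∈ A, b n‖ ≤ C * ‖∑ n ∈ B, b n‖

/-- `Λ` is an admissible choice of indices for the `N`-th greedy approximation of `x`: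
it has `N` elements and `min_{n ∈ Λ} |a_n| ≥ max_{n ∉ Λ} |a_n|`, where the `a_n` are the
coefficients of `x`. -/
def IsGreedySet (b : UnconditionalSchauderBasis ℕ 𝕜 X) (x : X) (N : ℕ) (Λ : Finset ℕ) : Prop :=
  Λ.card = N ∧ ∀ i ∈ Λ, ∀ j ∉ Λ, ‖b.coord j x‖ ≤ ‖b.coord i x‖

/-- `∑_{n ∈ Λ} a_n x_n`; for a greedy set `Λ` with `N` elements this is the greedy
approximation `𝒢_N(x)` given by that choice. -/
def greedyApprox (b : UnconditionalSchauderBasis ℕ 𝕜 X) (x : X) (Λ : Finset ℕ) : X :=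
  ∑ n ∈ Λ, b.coord n x • b n

/-- The error `σ_N(x)` of the best `N`-term approximation. -/
def bestError (b : UnconditionalSchauderBasis ℕ 𝕜 X) (x : X) (N : ℕ) : ℝ≥0∞ :=
  ⨅ (Λ : Finset ℕ) (_ : Λ.card = N) (c : ℕ → 𝕜), ‖x - ∑ n ∈ Λ, c n • b n‖ₑ

/-- The error `γ_N(x)` of greedy approximation: the largest value of `‖x - 𝒢_N(x)‖` over all
admissible choices of `𝒢_N(x)`. -/
def greedyError (b : UnconditionalSchauderBasis ℕ 𝕜 X) (x : X) (N : ℕ) : ℝ≥0∞ :=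
  ⨆ (Λ : Finset ℕ) (_ : IsGreedySet b x N Λ), ‖x - greedyApprox b x Λ‖ₑ

/-- The basis is greedy: `‖x - 𝒢_N(x)‖ ≤ C σ_N(x)` for all `x`, all `N ≥ 1` and every admissible
choice of `𝒢_N(x)`. -/
def IsGreedy (b : UnconditionalSchauderBasis ℕ 𝕜 X) : Prop :=
  ∃ C : ℝ≥0, ∀ (x : X) (N : ℕ), 1 ≤ N → ∀ Λ : Finset ℕ, IsGreedySet b x N Λ →
    ‖x - greedyApprox b x Λ‖ₑ ≤ C * bestError b x N

/-- For a sequence of errors `e_1, e_2, …`: the quantity `[∑_{N ≥ 1} (N^α e_N)^q / N]^{1/q}` if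
`q < ∞`, and `sup_{N ≥ 1} N^α e_N` if `q = ∞`. -/
def rateNorm (α : ℝ) (q : ℝ≥0∞) (e : ℕ → ℝ≥0∞) : ℝ≥0∞ :=
  if q = ∞ then ⨆ N : ℕ, ((N + 1 : ℕ) : ℝ≥0∞) ^ α * e (N + 1)
  else (∑' N : ℕ, (((N + 1 : ℕ) : ℝ≥0∞) ^ α * e (N + 1)) ^ q.toReal / ((N + 1 : ℕ) : ℝ≥0∞))
    ^ (1 / q.toReal)

/-- `‖x‖_{𝒜^α_q}`, with value `∞` exactly if `x ∉ 𝒜^α_q`. -/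
def approxNorm (b : UnconditionalSchauderBasis ℕ 𝕜 X) (α : ℝ) (q : ℝ≥0∞) (x : X) : ℝ≥0∞ :=
  ‖x‖ₑ + rateNorm α q (bestError b x)

/-- `‖x‖_{𝒢^α_q}`, with value `∞` exactly if `x ∉ 𝒢^α_q`. -/
def greedyNorm (b : UnconditionalSchauderBasis ℕ 𝕜 X) (α : ℝ) (q : ℝ≥0∞) (x : X) : ℝ≥0∞ :=
  ‖x‖ₑ + rateNorm α q (greedyError b x)

/-- The approximation space `𝒜^α_q`, as a set. -/
def approxSpace (b : UnconditionalSchauderBasis ℕ 𝕜 X) (α : ℝ) (q : ℝ≥0∞) : Set X :=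
  {x | approxNorm b α q x < ∞}

/-- Greedy approximation is optimal for `α` and `q`: `‖x‖_{𝒢^α_q} ≤ C ‖x‖_{𝒜^α_q}` for all
`x ∈ 𝒜^α_q`. -/
def IsOptimal (b : UnconditionalSchauderBasis ℕ 𝕜 X) (α : ℝ) (q : ℝ≥0∞) : Prop :=
  ∃ C : ℝ≥0, ∀ x ∈ approxSpace b α q, greedyNorm b α q x ≤ C * approxNorm b α q x

end

end GreedyBasis

/-! Write `K` for the bound on the coordinate projections and `1_A` for `∑ n ∈ A, b n`. The
implications run in a circle.

Democracy gives greediness by an exchange argument (`norm_sub_greedyApprox_le`): the part of `x`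
that a competitor `P` captures and the greedy set `Λ` misses has coefficients no larger than those
on `Λ \ P`. Unconditionality compares both parts with multiples of indicators, and democracy
compares the indicators. Greediness gives optimality because rate norms are monotone and
homogeneous.

Optimality gives democracy by testing on `x = 1_A + 1_B`, with `A`, `B` disjoint, `#A = n` and `#B =
M n`. Greedy selection may exhaust `B` first, so its error stays at least `‖1_A‖ / K` up to step `M
n`, whereas the best approximation can remove `A` within `n` steps and is left with at most `‖1_B‖`.
The rate norms therefore give `M^α ‖1_A‖ ≲ ‖1_A‖ + (M + 1)^α ‖1_B‖`, and a large fixed `M` absorbs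
the term `‖1_A‖` on the right. -/

namespace GreedyBasis

open Finset

/-! ### Bounded multipliers on finite sums -/

section Multipliers

variable {𝕜 X ι : Type*} [RCLike 𝕜] [NormedAddCommGroup X] [NormedSpace 𝕜 X]

/-- If all partial sums of a finite real family are bounded by `B`, then the sum of the absolute
values is bounded by `2 * B`. -/
lemma sum_abs_le_of_abs_sum_le {S : Finset ι} {f : ι → ℝ} {B : ℝ}
    (hB : ∀ T ⊆ S, |∑ i ∈ T, f i| ≤ B) : ∑ i ∈ S, |f i| ≤ 2 * B := by
  classical
  rw [← sum_filter_add_sum_filter_not S (fun i => 0 ≤ f i)]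
  have h₁ : ∑ i ∈ S with 0 ≤ f i, |f i| = ∑ i ∈ S with 0 ≤ f i, f i :=
    sum_congr rfl fun i hi => abs_of_nonneg (mem_filter.1 hi).2
  have h₂ : ∑ i ∈ S with ¬ 0 ≤ f i, |f i| = -∑ i ∈ S with ¬ 0 ≤ f i, f i := by
    rw [← sum_neg_distrib]
    exact sum_congr rfl fun i hi => abs_of_neg (not_le.1 (mem_filter.1 hi).2)
  have h₃ := (abs_le.1 (hB _ (filter_subset (fun i => 0 ≤ f i) S))).2
  have h₄ := (abs_le.1 (hB _ (filter_subset (fun i => ¬ 0 ≤ f i) S))).1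
  rw [h₁, h₂]
  linarith

lemma norm_le_abs_re_add_abs_im (z : 𝕜) : ‖z‖ ≤ |RCLike.re z| + |RCLike.im z| := by
  refine (sq_le_sq₀ (norm_nonneg z) (by positivity)).1 ?_
  rw [← RCLike.normSq_eq_def', RCLike.normSq_apply, ← abs_mul_abs_self (RCLike.re z),
    ← abs_mul_abs_self (RCLike.im z)]
  nlinarith [mul_nonneg (abs_nonneg (RCLike.re z)) (abs_nonneg (RCLike.im z))]

/-- If all partial sums of a finite family of vectors are bounded by `B`, then multiplying the
vectors by scalars bounded by `M` gives a sum bounded by `4 * B * M`. -/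
lemma norm_sum_smul_le {S : Finset ι} {v : ι → X} {m : ι → 𝕜} {B M : ℝ}
    (hB : ∀ T ⊆ S, ‖∑ i ∈ T, v i‖ ≤ B) (hm : ∀ i ∈ S, ‖m i‖ ≤ M) (hM : 0 ≤ M) :
    ‖∑ i ∈ S, m i • v i‖ ≤ 4 * B * M := by
  -- A norming functional reduces the bound to scalars; real and imaginary parts contribute `2 * B`
  -- each.
  obtain ⟨φ, hφ, hφ'⟩ := exists_dual_vector'' 𝕜 (∑ i ∈ S, m i • v i)
  have hφB : ∀ T ⊆ S, ‖∑ i ∈ T, φ (v i)‖ ≤ B := fun T hT => by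
    rw [← map_sum]
    exact ((φ.le_of_opNorm_le hφ _).trans_eq (one_mul _)).trans (hB T hT)
  have hre : ∑ i ∈ S, |RCLike.re (φ (v i))| ≤ 2 * B := sum_abs_le_of_abs_sum_le fun T hT => by
    rw [← map_sum]
    exact (RCLike.abs_re_le_norm _).trans (hφB T hT)
  have him : ∑ i ∈ S, |RCLike.im (φ (v i))| ≤ 2 * B := sum_abs_le_of_abs_sum_le fun T hT => by
    rw [← map_sum]
    exact (RCLike.abs_im_le_norm _).trans (hφB T hT)
  have hsum : ∑ i ∈ S, ‖φ (v i)‖ ≤ 4 * B := by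
    calc ∑ i ∈ S, ‖φ (v i)‖
        ≤ ∑ i ∈ S, (|RCLike.re (φ (v i))| + |RCLike.im (φ (v i))|) :=
          sum_le_sum fun i _ => norm_le_abs_re_add_abs_im _
      _ ≤ 4 * B := by rw [sum_add_distrib]; linarith
  calc ‖∑ i ∈ S, m i • v i‖ = ‖φ (∑ i ∈ S, m i • v i)‖ := by simp [hφ']
    _ ≤ ∑ i ∈ S, ‖φ (v i)‖ * M := by
      rw [map_sum]
      refine norm_sum_le_of_le _ fun i hi => ?_
      rw [map_smul, norm_smul, mul_comm]
      exact mul_le_mul_of_nonneg_left (hm i hi) (norm_nonneg _)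
    _ ≤ 4 * B * M := by
      rw [← sum_mul]
      exact mul_le_mul_of_nonneg_right hsum hM

end Multipliers

/-! ### Unconditionality, and democracy implies greediness -/

section Basis

variable {𝕜 X : Type*} [RCLike 𝕜] [NormedAddCommGroup X] [NormedSpace 𝕜 X]

lemma coord_sum_smul (b : UnconditionalSchauderBasis ℕ 𝕜 X) (S : Finset ℕ) (c : ℕ → 𝕜) (j : ℕ) :
    b.coord j (∑ n ∈ S, c n • b n) = if j ∈ S then c j else 0 := by
  simp [map_sum, b.ortho, Pi.single_apply]

lemma coord_sum (b : UnconditionalSchauderBasis ℕ 𝕜 X) (S : Finset ℕ) (j : ℕ) :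
    b.coord j (∑ n ∈ S, b n) = if j ∈ S then 1 else 0 := by
  simpa using coord_sum_smul b S (fun _ => 1) j

lemma proj_sum_smul (b : UnconditionalSchauderBasis ℕ 𝕜 X) (S T : Finset ℕ) (c : ℕ → 𝕜) :
    b.proj T (∑ n ∈ S, c n • b n) = ∑ n ∈ T ∩ S, c n • b n := by
  simp only [GeneralSchauderBasis.proj_apply, coord_sum_smul, ite_smul, zero_smul, sum_ite_mem]

variable [CompleteSpace X]

lemma norm_proj_apply_le (b : UnconditionalSchauderBasis ℕ 𝕜 X) (T : Finset ℕ) (x : X) :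
    ‖b.proj T x‖ ≤ b.nnnormProjBound * ‖x‖ :=
  (b.proj T).le_of_opNorm_le (b.norm_proj_le_nnnormProjBound T) x

lemma norm_sum_smul_le_of_subset (b : UnconditionalSchauderBasis ℕ 𝕜 X) {S T : Finset ℕ}
    (h : T ⊆ S) (c : ℕ → 𝕜) :
    ‖∑ n ∈ T, c n • b n‖ ≤ b.nnnormProjBound * ‖∑ n ∈ S, c n • b n‖ := by
  have := norm_proj_apply_le b T (∑ n ∈ S, c n • b n)
  rwa [proj_sum_smul, inter_eq_left.2 h] at this

lemma norm_sum_le_of_subset (b : UnconditionalSchauderBasis ℕ 𝕜 X) {S T : Finset ℕ}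
    (h : T ⊆ S) : ‖∑ n ∈ T, b n‖ ≤ b.nnnormProjBound * ‖∑ n ∈ S, b n‖ := by
  simpa using norm_sum_smul_le_of_subset b h (fun _ => (1 : 𝕜))

/-- Coefficients bounded above by `t` give a norm bounded by that of `t` times the indicator. -/
lemma norm_sum_smul_le_mul_norm_sum (b : UnconditionalSchauderBasis ℕ 𝕜 X) {S : Finset ℕ}
    {c : ℕ → 𝕜} {t : ℝ} (ht : 0 ≤ t) (hc : ∀ n ∈ S, ‖c n‖ ≤ t) :
    ‖∑ n ∈ S, c n • b n‖ ≤ 4 * (b.nnnormProjBound * ‖∑ n ∈ S, b n‖) * t :=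
  norm_sum_smul_le (fun _ hT => norm_sum_le_of_subset b hT) hc ht

/-- Coefficients bounded below by `t` give a norm bounded below by that of `t` times the
indicator. -/
lemma mul_norm_sum_le_norm_sum_smul (b : UnconditionalSchauderBasis ℕ 𝕜 X) {S : Finset ℕ}
    {c : ℕ → 𝕜} {t : ℝ} (ht : 0 ≤ t) (hc : ∀ n ∈ S, t ≤ ‖c n‖) :
    t * ‖∑ n ∈ S, b n‖ ≤ 4 * (b.nnnormProjBound * ‖∑ n ∈ S, c n • b n‖) := by
  -- The multipliers `t / c n` have modulus at most 1; if `c n = 0`, then `t = 0` as well.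
  have h : (t : 𝕜) • ∑ n ∈ S, b n = ∑ n ∈ S, ((t : 𝕜) / c n) • c n • b n := by
    rw [smul_sum]
    refine sum_congr rfl fun n hn => ?_
    rw [smul_smul]
    rcases eq_or_ne (c n) 0 with h0 | h0
    · have : t = 0 := le_antisymm (by simpa [h0] using hc n hn) ht
      simp [this]
    · rw [div_mul_cancel₀ _ h0]
  have h' : t * ‖∑ n ∈ S, b n‖ = ‖(t : 𝕜) • ∑ n ∈ S, b n‖ := by
    rw [norm_smul, RCLike.norm_ofReal, abs_of_nonneg ht]
  rw [h', h, ← mul_one (4 * _)]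
  refine norm_sum_smul_le (fun _ hT => norm_sum_smul_le_of_subset b hT c) (fun n hn => ?_)
    zero_le_one
  rw [norm_div, RCLike.norm_ofReal, abs_of_nonneg ht]
  exact div_le_one_of_le₀ (hc n hn) (norm_nonneg _)

/-- Off `Λ ∪ P` the remainder is that of `y`, which costs `1 + K`. On `P \ Λ` it is exchanged for `Λ
\ P`, where `x` and `y` have the same coefficients: two multiplier bounds give `16 * K ^ 2`, the
projection of `y` another `K`, and democracy `D`. -/
lemma norm_sub_greedyApprox_le (b : UnconditionalSchauderBasis ℕ 𝕜 X) {D : ℝ} (hD : 0 ≤ D)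
    (hdem : ∀ A B : Finset ℕ, A.card = B.card → ‖∑ n ∈ A, b n‖ ≤ D * ‖∑ n ∈ B, b n‖)
    {x : X} {N : ℕ} {Λ P : Finset ℕ} (hΛ : IsGreedySet b x N Λ) (hP : P.card = N) (c : ℕ → 𝕜) :
    ‖x - greedyApprox b x Λ‖ ≤
      (1 + (b.nnnormProjBound : ℝ) + 16 * D * (b.nnnormProjBound : ℝ) ^ 3) *
        ‖x - ∑ n ∈ P, c n • b n‖ := by
  set K : ℝ := (b.nnnormProjBound : ℝ)
  have hK : 0 ≤ K := NNReal.coe_nonneg _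
  set y := x - ∑ n ∈ P, c n • b n with hy
  have hcard : (P \ Λ).card = (Λ \ P).card := by
    rw [card_sdiff_comm (hP.trans hΛ.1.symm)]
  have hsplit : x - greedyApprox b x Λ = (y - b.proj (Λ ∪ P) y) + b.proj (P \ Λ) x := by
    have h₁ : b.proj (Λ ∪ P) y = b.proj (Λ ∪ P) x - ∑ n ∈ P, c n • b n := by
      rw [hy, map_sub, proj_sum_smul, union_inter_cancel_right]
    have h₂ : b.proj (Λ ∪ P) x = b.proj Λ x + b.proj (P \ Λ) x := by
      simp only [GeneralSchauderBasis.proj_apply]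
      rw [← sum_union disjoint_sdiff, union_sdiff_self_eq_union]
    have h₃ : greedyApprox b x Λ = b.proj Λ x := by simp [greedyApprox]
    rw [h₁, h₂, h₃, hy]
    abel
  have hfirst : ‖y - b.proj (Λ ∪ P) y‖ ≤ (1 + K) * ‖y‖ := by
    have := norm_sub_le y (b.proj (Λ ∪ P) y)
    have := norm_proj_apply_le b (Λ ∪ P) y
    linarith
  have hsecond : ‖b.proj (P \ Λ) x‖ ≤ 16 * D * K ^ 3 * ‖y‖ := by
    rcases (Λ \ P).eq_empty_or_nonempty with he | hne
    · have : P \ Λ = ∅ := by rw [← card_eq_zero, hcard, he, card_empty]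
      rw [this]
      simpa using by positivity
    obtain ⟨i, hi, hmin⟩ := exists_min_image (Λ \ P) (fun n => ‖b.coord n x‖) hne
    have hupper : ‖b.proj (P \ Λ) x‖ ≤ 4 * (K * ‖∑ n ∈ P \ Λ, b n‖) * ‖b.coord i x‖ := by
      rw [GeneralSchauderBasis.proj_apply]
      exact norm_sum_smul_le_mul_norm_sum b (norm_nonneg _) fun n hn =>
        hΛ.2 i (mem_sdiff.1 hi).1 n (mem_sdiff.1 hn).2
    have hlower : ‖b.coord i x‖ * ‖∑ n ∈ Λ \ P, b n‖ ≤ 4 * (K * ‖b.proj (Λ \ P) x‖) := by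
      rw [GeneralSchauderBasis.proj_apply]
      exact mul_norm_sum_le_norm_sum_smul b (norm_nonneg _) hmin
    have hproj : b.proj (Λ \ P) x = b.proj (Λ \ P) y := by
      rw [hy, map_sub, proj_sum_smul, sdiff_inter_self, sum_empty, sub_zero]
    calc ‖b.proj (P \ Λ) x‖ ≤ 4 * (K * ‖∑ n ∈ P \ Λ, b n‖) * ‖b.coord i x‖ := hupper
      _ ≤ 4 * (K * (D * ‖∑ n ∈ Λ \ P, b n‖)) * ‖b.coord i x‖ := by
        gcongr
        exact hdem _ _ hcard
      _ = 4 * K * D * (‖b.coord i x‖ * ‖∑ n ∈ Λ \ P, b n‖) := by ring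
      _ ≤ 4 * K * D * (4 * (K * (K * ‖y‖))) := by
        refine mul_le_mul_of_nonneg_left (hlower.trans ?_) (by positivity)
        rw [hproj]
        gcongr
        exact norm_proj_apply_le b _ y
      _ = 16 * D * K ^ 3 * ‖y‖ := by ring
  rw [hsplit]
  have := norm_add_le (y - b.proj (Λ ∪ P) y) (b.proj (P \ Λ) x)
  linarith

theorem IsDemocratic.isGreedy {b : UnconditionalSchauderBasis ℕ 𝕜 X} (h : IsDemocratic b) :
    IsGreedy b := by
  obtain ⟨D, hD⟩ := h
  have hD' : ∀ A B : Finset ℕ, A.card = B.card →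
      ‖∑ n ∈ A, b n‖ ≤ max D 0 * ‖∑ n ∈ B, b n‖ := fun A B hAB =>
    (hD A B hAB).trans (mul_le_mul_of_nonneg_right (le_max_left _ _) (norm_nonneg _))
  refine ⟨1 + b.nnnormProjBound + 16 * (max D 0).toNNReal * b.nnnormProjBound ^ 3,
    fun x N _ Λ hΛ => ?_⟩
  have h₀ : ((1 + b.nnnormProjBound + 16 * (max D 0).toNNReal * b.nnnormProjBound ^ 3 : ℝ≥0) :
      ℝ≥0∞) ≠ 0 := by
    rw [ENNReal.coe_ne_zero]
    positivity
  simp only [bestError, ENNReal.mul_iInf_of_ne h₀ ENNReal.coe_ne_top]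
  refine le_iInf fun P => le_iInf fun hP => le_iInf fun c => ?_
  rw [enorm_eq_nnnorm, enorm_eq_nnnorm, ← ENNReal.coe_mul, ENNReal.coe_le_coe, ← NNReal.coe_le_coe]
  have := norm_sub_greedyApprox_le b (le_max_right D 0) hD' hΛ hP c
  simpa [Real.coe_toNNReal', mul_assoc] using this

end Basis

/-! ### Estimates for rate norms -/

section RateNorm

lemma rateNorm_top (α : ℝ) (e : ℕ → ℝ≥0∞) :
    rateNorm α ∞ e = ⨆ N : ℕ, ((N + 1 : ℕ) : ℝ≥0∞) ^ α * e (N + 1) :=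
  if_pos rfl

lemma rateNorm_of_ne_top (α : ℝ) {q : ℝ≥0∞} (hq : q ≠ ∞) (e : ℕ → ℝ≥0∞) :
    rateNorm α q e = (∑' N : ℕ, (((N + 1 : ℕ) : ℝ≥0∞) ^ α * e (N + 1)) ^ q.toReal /
      ((N + 1 : ℕ) : ℝ≥0∞)) ^ (1 / q.toReal) :=
  if_neg hq

lemma rateNorm_le_mul {α : ℝ} {q : ℝ≥0∞} (hq : 0 < q) {e f : ℕ → ℝ≥0∞} {C : ℝ≥0∞}
    (h : ∀ N, 1 ≤ N → e N ≤ C * f N) : rateNorm α q e ≤ C * rateNorm α q f := by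
  rcases eq_or_ne q ∞ with rfl | hq'
  · rw [rateNorm_top, rateNorm_top, ENNReal.mul_iSup]
    refine iSup_mono fun N => ?_
    rw [mul_left_comm]
    gcongr
    exact h _ (Nat.le_add_left 1 N)
  · have hr : 0 < q.toReal := ENNReal.toReal_pos hq.ne' hq'
    rw [rateNorm_of_ne_top α hq', rateNorm_of_ne_top α hq']
    calc _ ≤ (C ^ q.toReal * ∑' N : ℕ, (((N + 1 : ℕ) : ℝ≥0∞) ^ α * f (N + 1)) ^ q.toReal /
          ((N + 1 : ℕ) : ℝ≥0∞)) ^ (1 / q.toReal) := by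
          rw [← ENNReal.tsum_mul_left]
          gcongr with N
          rw [← mul_div_assoc, ← ENNReal.mul_rpow_of_nonneg _ _ hr.le, mul_left_comm C]
          gcongr
          exact h _ (Nat.le_add_left 1 N)
      _ = _ := by
          rw [ENNReal.mul_rpow_of_nonneg _ _ (by positivity), one_div,
            ENNReal.rpow_rpow_inv (ne_of_gt hr)]

/-- `∑_{k ≤ n} k^(s-1)` is at most a multiple of `n^s`. -/
lemma sum_rpow_sub_one_le {s : ℝ} (hs : 0 < s) (n : ℕ) :
    ∑ k ∈ range n, ((k + 1 : ℕ) : ℝ) ^ (s - 1) ≤ (min s 1)⁻¹ * (n : ℝ) ^ s := by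
  have hr : 0 < min s 1 := lt_min hs one_pos
  induction n with
  | zero => simp [Real.zero_rpow hs.ne']
  | succ n ih =>
    rw [sum_range_succ]
    set m : ℝ := ((n + 1 : ℕ) : ℝ) with hm
    have hm1 : 1 ≤ m := by rw [hm]; exact_mod_cast Nat.le_add_left 1 n
    have hm0 : 0 < m := by linarith
    have hn : (n : ℝ) = m * (1 + -(1 / m)) := by
      rw [hm]; push_cast; field_simp; ring
    have hinv : 1 / m ≤ 1 := (div_le_one hm0).2 hm1
    have h0 : 0 ≤ 1 + -(1 / m) := by linarith
    -- Bernoulli's upper bound needs an exponent at most 1. Since the base lies in `[0, 1]`, `s` may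
    -- be lowered to `min s 1`.
    have hbern : (1 + -(1 / m)) ^ s ≤ 1 + min s 1 * -(1 / m) := by
      refine le_trans (Real.rpow_le_rpow_of_exponent_ge' h0 ?_ hr.le (min_le_left s 1)) ?_
      · have : 0 < 1 / m := by positivity
        linarith
      · exact rpow_one_add_le_one_add_mul_self (by linarith) hr.le (min_le_right _ _)
    have hns : (n : ℝ) ^ s ≤ m ^ s * (1 + min s 1 * -(1 / m)) := by
      rw [hn, Real.mul_rpow hm0.le h0]
      exact mul_le_mul_of_nonneg_left hbern (by positivity)
    have hms : m ^ (s - 1) = m ^ s / m := Real.rpow_sub_one hm0.ne' s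
    calc _ ≤ (min s 1)⁻¹ * (m ^ s * (1 + min s 1 * -(1 / m))) + m ^ (s - 1) := by
          gcongr
          exact ih.trans (by gcongr)
      _ = (min s 1)⁻¹ * m ^ s := by
        rw [hms]
        field_simp
        ring

lemma weight_eq (α : ℝ) {r : ℝ} (hr : 0 < r) (N : ℕ) (t : ℝ≥0∞) :
    (((N + 1 : ℕ) : ℝ≥0∞) ^ α * t) ^ r / ((N + 1 : ℕ) : ℝ≥0∞) =
      t ^ r * ENNReal.ofReal (((N + 1 : ℕ) : ℝ) ^ (α * r - 1)) := by
  have h0 : ((N + 1 : ℕ) : ℝ≥0∞) ≠ 0 := by simp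
  have hpos : (0 : ℝ) < ((N + 1 : ℕ) : ℝ) := by positivity
  rw [← ENNReal.ofReal_rpow_of_pos hpos, ENNReal.ofReal_natCast,
    ENNReal.rpow_sub _ _ h0 (ENNReal.natCast_ne_top _), ENNReal.rpow_one,
    ENNReal.mul_rpow_of_nonneg _ _ hr.le, ← ENNReal.rpow_mul, mul_comm, mul_div_assoc]

lemma sum_weight_le {α r : ℝ} (hα : 0 < α) (hr : 0 < r) (n : ℕ) (t : ℝ≥0∞) :
    ∑ N ∈ range n, (((N + 1 : ℕ) : ℝ≥0∞) ^ α * t) ^ r / ((N + 1 : ℕ) : ℝ≥0∞) ≤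
      ENNReal.ofReal (min (α * r) 1)⁻¹ * ((n : ℝ≥0∞) ^ α * t) ^ r := by
  have hs : 0 < α * r := mul_pos hα hr
  simp only [weight_eq α hr]
  rw [← mul_sum, ← ENNReal.ofReal_sum_of_nonneg fun k _ => by positivity]
  calc _ ≤ t ^ r * ENNReal.ofReal ((min (α * r) 1)⁻¹ * (n : ℝ) ^ (α * r)) := by
        gcongr
        exact sum_rpow_sub_one_le hs n
    _ = _ := by
        rw [ENNReal.ofReal_mul (by positivity), ← ENNReal.ofReal_rpow_of_nonneg (by positivity) hs.le,
          ENNReal.ofReal_natCast, ENNReal.mul_rpow_of_nonneg _ _ hr.le, ← ENNReal.rpow_mul]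
        ring

/-- Errors that are at most `s` up to `n`, at most `t` afterwards and zero beyond `L` have a rate
norm controlled by `n^α s + L^α t`. -/
lemma exists_rateNorm_le {α : ℝ} (hα : 0 < α) {q : ℝ≥0∞} (hq : 0 < q) :
    ∃ E : ℝ≥0, ∀ (n L : ℕ) (s t : ℝ≥0∞) (e : ℕ → ℝ≥0∞), (∀ k ≤ n, e k ≤ s) →
      (∀ k, n < k → e k ≤ t) → (∀ k, L < k → e k = 0) →
      rateNorm α q e ≤ E * ((n : ℝ≥0∞) ^ α * s + (L : ℝ≥0∞) ^ α * t) := by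
  rcases eq_or_ne q ∞ with rfl | hq'
  · refine ⟨1, fun n L s t e hs ht hL => ?_⟩
    rw [rateNorm_top, ENNReal.coe_one, one_mul]
    refine iSup_le fun N => ?_
    rcases le_or_gt (N + 1) n with hn | hn
    · refine le_trans ?_ le_self_add
      gcongr
      exact hs _ hn
    rcases le_or_gt (N + 1) L with hN | hN
    · refine le_trans ?_ le_add_self
      gcongr
      exact ht _ hn
    · simp [hL _ hN]
  · set r := q.toReal with hrdef
    have hr : 0 < r := ENNReal.toReal_pos hq.ne' hq'
    set D := ENNReal.ofReal (min (α * r) 1)⁻¹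
    -- Bounding `u ^ r` and `v ^ r` each by `(u + v) ^ r` costs the factor 2 and works for every `r
    -- > 0`, including `r < 1`.
    have hD : (2 * D) ^ (1 / r) ≠ ∞ :=
      ENNReal.rpow_ne_top_of_nonneg (by positivity)
        (ENNReal.mul_ne_top ENNReal.ofNat_ne_top ENNReal.ofReal_ne_top)
    refine ⟨((2 * D) ^ (1 / r)).toNNReal, fun n L s t e hs ht hL => ?_⟩
    rw [ENNReal.coe_toNNReal hD, rateNorm_of_ne_top α hq', ← hrdef]
    set w : ℝ≥0∞ → ℕ → ℝ≥0∞ := fun t N =>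
      (((N + 1 : ℕ) : ℝ≥0∞) ^ α * t) ^ r / ((N + 1 : ℕ) : ℝ≥0∞) with hw
    have hterm : ∀ N, w (e (N + 1)) N ≤
        (if N ∈ range n then w s N else 0) + if N ∈ range L then w t N else 0 := fun N => by
      rcases le_or_gt (N + 1) n with hn | hn
      · rw [if_pos (mem_range.2 hn)]
        refine le_trans ?_ le_self_add
        simp only [hw]
        gcongr
        exact hs _ hn
      rcases le_or_gt (N + 1) L with hN | hN
      · rw [if_pos (mem_range.2 hN)]
        refine le_trans ?_ le_add_self
        simp only [hw]
        gcongr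
        exact ht _ hn
      · simp [hw, hL _ hN, hr]
    have htsum : ∀ (m : ℕ) (u : ℝ≥0∞), ∑' N, (if N ∈ range m then w u N else 0) ≤
        D * ((m : ℝ≥0∞) ^ α * u) ^ r := fun m u => by
      rw [tsum_eq_sum (s := range m) fun N hN => if_neg hN, sum_ite_mem, inter_self]
      exact sum_weight_le hα hr m u
    set u := (n : ℝ≥0∞) ^ α * s
    set v := (L : ℝ≥0∞) ^ α * t
    calc (∑' N, w (e (N + 1)) N) ^ (1 / r) ≤ (2 * D * (u + v) ^ r) ^ (1 / r) := by
          gcongr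
          calc ∑' N, w (e (N + 1)) N ≤ D * u ^ r + D * v ^ r := by
                refine (ENNReal.tsum_le_tsum hterm).trans ?_
                rw [ENNReal.tsum_add]
                exact add_le_add (htsum n s) (htsum L t)
            _ ≤ D * (u + v) ^ r + D * (u + v) ^ r := by
                gcongr
                · exact le_self_add
                · exact le_add_self
            _ = 2 * D * (u + v) ^ r := by ring
      _ = (2 * D) ^ (1 / r) * (u + v) := by
          rw [ENNReal.mul_rpow_of_nonneg _ _ (by positivity), one_div, ENNReal.rpow_rpow_inv (ne_of_gt hr)]

/-- Errors that are at least `t` up to `n` have a rate norm at least a multiple of `n^α t`. -/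
lemma exists_le_rateNorm {α : ℝ} (hα : 0 < α) {q : ℝ≥0∞} (hq : 0 < q) :
    ∃ c : ℝ≥0, 0 < c ∧ ∀ (n : ℕ) (t : ℝ≥0∞) (e : ℕ → ℝ≥0∞), 1 ≤ n → (∀ k ≤ n, t ≤ e k) →
      c * ((n : ℝ≥0∞) ^ α * t) ≤ rateNorm α q e := by
  rcases eq_or_ne q ∞ with rfl | hq'
  · refine ⟨1, one_pos, fun n t e hn ht => ?_⟩
    rw [rateNorm_top, ENNReal.coe_one, one_mul]
    refine le_iSup_of_le (n - 1) ?_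
    rw [Nat.sub_add_cancel hn]
    gcongr
    exact ht n le_rfl
  · set r := q.toReal with hrdef
    have hr : 0 < r := ENNReal.toReal_pos hq.ne' hq'
    refine ⟨(2⁻¹ : ℝ≥0) ^ (1 / r) * (2⁻¹ : ℝ≥0) ^ α, by positivity, fun n t e hn ht => ?_⟩
    rw [rateNorm_of_ne_top α hq', ← hrdef, ENNReal.coe_mul,
      ENNReal.coe_rpow_of_nonneg _ (by positivity), ENNReal.coe_rpow_of_nonneg _ hα.le,
      ENNReal.coe_inv two_ne_zero, ENNReal.coe_ofNat]
    have hn0 : (n : ℝ≥0∞) ≠ 0 := by simpa using Nat.one_le_iff_ne_zero.1 hn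
    set u := (2⁻¹ : ℝ≥0∞) ^ α * ((n : ℝ≥0∞) ^ α * t)
    -- The upper half of the range suffices: it has at least `n / 2` terms, each with weight
    -- comparable to that at `n`.
    have hterm : ∀ N ∈ Ico (n / 2) n, u ^ r / n ≤
        (((N + 1 : ℕ) : ℝ≥0∞) ^ α * e (N + 1)) ^ r / ((N + 1 : ℕ) : ℝ≥0∞) := fun N hN => by
      rw [mem_Ico] at hN
      have hhalf : (2⁻¹ : ℝ≥0∞) * n ≤ ((N + 1 : ℕ) : ℝ≥0∞) := by
        rw [mul_comm, ← div_eq_mul_inv]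
        refine ENNReal.div_le_of_le_mul ?_
        have : n ≤ (N + 1) * 2 := by omega
        exact_mod_cast this
      have hle : ((N + 1 : ℕ) : ℝ≥0∞) ≤ n := by exact_mod_cast hN.2
      have hu : u = (2⁻¹ * (n : ℝ≥0∞)) ^ α * t := by
        rw [ENNReal.mul_rpow_of_nonneg _ _ hα.le, mul_assoc]
      rw [hu]
      gcongr
      exact ht _ hN.2
    have hcount : (2⁻¹ : ℝ≥0∞) * n ≤ ((Ico (n / 2) n).card : ℝ≥0∞) := by
      rw [mul_comm, ← div_eq_mul_inv, Nat.card_Ico]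
      refine ENNReal.div_le_of_le_mul ?_
      have : n ≤ (n - n / 2) * 2 := by omega
      exact_mod_cast this
    calc (2⁻¹ : ℝ≥0∞) ^ (1 / r) * 2⁻¹ ^ α * ((n : ℝ≥0∞) ^ α * t)
        = (2⁻¹ * u ^ r) ^ (1 / r) := by
          rw [ENNReal.mul_rpow_of_nonneg _ _ (by positivity), one_div,
            ENNReal.rpow_rpow_inv hr.ne', mul_assoc]
      _ ≤ _ := by
          gcongr
          calc 2⁻¹ * u ^ r = 2⁻¹ * n * (u ^ r / n) := by
                rw [mul_assoc, ENNReal.mul_div_cancel hn0 (ENNReal.natCast_ne_top n)]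
            _ ≤ (Ico (n / 2) n).card * (u ^ r / n) := by gcongr
            _ ≤ _ := by
                rw [← nsmul_eq_mul]
                exact (card_nsmul_le_sum _ _ _ hterm).trans (ENNReal.sum_le_tsum _)

end RateNorm

/-! ### Greediness implies optimality, and optimality implies democracy -/

section Optimality

variable {𝕜 X : Type*} [RCLike 𝕜] [NormedAddCommGroup X] [NormedSpace 𝕜 X]

theorem IsGreedy.isOptimal {b : UnconditionalSchauderBasis ℕ 𝕜 X} (h : IsGreedy b) (α : ℝ)
    {q : ℝ≥0∞} (hq : 0 < q) : IsOptimal b α q := by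
  obtain ⟨C, hC⟩ := h
  refine ⟨1 + C, fun x _ => ?_⟩
  have hrate : rateNorm α q (greedyError b x) ≤ C * rateNorm α q (bestError b x) :=
    rateNorm_le_mul hq fun N hN => iSup₂_le (hC x N hN)
  rw [greedyNorm, approxNorm, ENNReal.coe_add, ENNReal.coe_one, add_mul, one_mul, mul_add]
  exact add_le_add le_self_add (hrate.trans le_add_self)

/-- Smaller supports are padded to exactly `N` indices with zero coefficients. -/
lemma bestError_le (b : UnconditionalSchauderBasis ℕ 𝕜 X) (x : X) {S : Finset ℕ} {N : ℕ}
    (h : S.card ≤ N) (c : ℕ → 𝕜) : bestError b x N ≤ ‖x - ∑ n ∈ S, c n • b n‖ₑ := by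
  obtain ⟨P, hSP, hP⟩ := Infinite.exists_superset_card_eq S N h
  refine iInf₂_le_of_le P hP (iInf_le_of_le (fun n => if n ∈ S then c n else 0) ?_)
  simp only [ite_smul, zero_smul, sum_ite_mem, inter_eq_right.2 hSP, le_refl]

lemma bestError_sum_union_le (b : UnconditionalSchauderBasis ℕ 𝕜 X) {A B : Finset ℕ}
    (h : Disjoint A B) {N : ℕ} (hN : A.card ≤ N) :
    bestError b (∑ n ∈ A ∪ B, b n) N ≤ ‖∑ n ∈ B, b n‖ₑ := by
  refine (bestError_le b _ hN fun _ => 1).trans_eq ?_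
  simp [sum_union h]

/-- A subadditivity bound: if the sums over subsets with at most `n` elements are bounded by `D`,
then sums over sets with at most `m * n` elements are bounded by `m * D`. -/
lemma norm_sum_le_mul_of_card_le {ι : Type*} {v : ι → X} {n m : ℕ} {D : ℝ} {A : Finset ι}
    (h : ∀ T ⊆ A, T.card ≤ n → ‖∑ i ∈ T, v i‖ ≤ D) (hA : A.card ≤ m * n) :
    ‖∑ i ∈ A, v i‖ ≤ m * D := by
  classical
  induction m generalizing A with
  | zero => simp [card_eq_zero.1 (Nat.le_zero.1 (by simpa using hA))]
  | succ m ih =>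
    obtain ⟨T, hTA, hT⟩ := exists_subset_card_eq (min_le_right n A.card)
    have hrest : (A \ T).card ≤ m * n := by
      rw [card_sdiff_of_subset hTA, hT]
      rw [Nat.add_mul, one_mul] at hA
      omega
    have h₁ := ih (fun S hS => h S (hS.trans sdiff_subset)) hrest
    have h₂ := h T hTA (hT.trans_le (min_le_left _ _))
    rw [← sum_sdiff hTA]
    push_cast
    linarith [norm_add_le (∑ i ∈ A \ T, v i) (∑ i ∈ T, v i)]

variable [CompleteSpace X]

/-- All nonzero coefficients equal 1, so any `k` elements of `B` form a greedy set, and its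
remainder still contains all of `A`. -/
lemma norm_sum_le_mul_greedyError (b : UnconditionalSchauderBasis ℕ 𝕜 X) {A B : Finset ℕ}
    (h : Disjoint A B) {k : ℕ} (hk : k ≤ B.card) :
    ‖∑ n ∈ A, b n‖ₑ ≤ b.nnnormProjBound * greedyError b (∑ n ∈ A ∪ B, b n) k := by
  obtain ⟨Λ, hΛB, hΛ⟩ := exists_subset_card_eq hk
  set x := ∑ n ∈ A ∪ B, b n with hx
  have hΛ' : IsGreedySet b x k Λ := by
    refine ⟨hΛ, fun i hi j _ => ?_⟩
    rw [hx, coord_sum, coord_sum, if_pos (mem_union_right A (hΛB hi))]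
    split_ifs <;> simp
  have hsub : x - greedyApprox b x Λ = ∑ n ∈ A ∪ (B \ Λ), b n := by
    have hG : greedyApprox b x Λ = ∑ n ∈ Λ, b n := sum_congr rfl fun n hn => by
      rw [hx, coord_sum, if_pos (mem_union_right A (hΛB hn)), one_smul]
    rw [hG, hx, sum_union h, sum_union (h.mono_right sdiff_subset), ← sum_sdiff hΛB]
    abel
  calc ‖∑ n ∈ A, b n‖ₑ ≤ b.nnnormProjBound * ‖∑ n ∈ A ∪ (B \ Λ), b n‖ₑ := by
        rw [enorm_eq_nnnorm, enorm_eq_nnnorm, ← ENNReal.coe_mul, ENNReal.coe_le_coe,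
          ← NNReal.coe_le_coe]
        exact norm_sum_le_of_subset b subset_union_left
    _ ≤ _ := by
        gcongr
        rw [← hsub]
        exact le_iSup₂_of_le Λ hΛ' le_rfl

lemma one_le_nnnormProjBound_mul (b : UnconditionalSchauderBasis ℕ 𝕜 X) (hb : ∀ n, ‖b n‖ = 1)
    {B : Finset ℕ} (hB : B.Nonempty) : 1 ≤ (b.nnnormProjBound : ℝ) * ‖∑ n ∈ B, b n‖ := by
  obtain ⟨n, hn⟩ := hB
  simpa [hb] using norm_sum_le_of_subset b (singleton_subset_iff.2 hn)

lemma nnnormProjBound_pos (b : UnconditionalSchauderBasis ℕ 𝕜 X) (hb : ∀ n, ‖b n‖ = 1) :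
    0 < b.nnnormProjBound := by
  have h := one_le_nnnormProjBound_mul b hb (singleton_nonempty 0)
  rw [sum_singleton, hb, mul_one] at h
  exact_mod_cast one_pos.trans_le h

lemma natCast_rpow_eq_coe {α : ℝ} (hα : 0 ≤ α) (n : ℕ) :
    (n : ℝ≥0∞) ^ α = (((n : ℝ≥0) ^ α : ℝ≥0) : ℝ≥0∞) := by
  rw [ENNReal.coe_rpow_of_nonneg _ hα, ENNReal.coe_natCast]

/-- If greedy approximation is optimal, then the norm of an indicator is controlled by the norm
of any disjoint indicator which is longer by a suitable factor `M`. -/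
lemma IsOptimal.exists_norm_sum_le {b : UnconditionalSchauderBasis ℕ 𝕜 X}
    (hb : ∀ n, ‖b n‖ = 1) {α : ℝ} (hα : 0 < α) {q : ℝ≥0∞} (hq : 0 < q) (h : IsOptimal b α q) :
    ∃ M : ℕ, 1 ≤ M ∧ ∃ D : ℝ, 0 ≤ D ∧ ∀ A B : Finset ℕ, Disjoint A B → A.Nonempty →
      B.card = M * A.card → ‖∑ n ∈ A, b n‖ ≤ D * ‖∑ n ∈ B, b n‖ := by
  obtain ⟨C, hC⟩ := h
  obtain ⟨E, hE⟩ := exists_rateNorm_le hα hq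
  obtain ⟨c, hc, hc'⟩ := exists_le_rateNorm hα hq
  have hK := nnnormProjBound_pos b hb
  set K := b.nnnormProjBound with hKdef
  have hcK : 0 < c / K := by positivity
  -- `C * (1 + E)` will be the coefficient of `u` in the upper bound; the extra 1 leaves one copy of
  -- `u` after cancellation.
  obtain ⟨M, hM, hM1⟩ : ∃ M : ℕ, C * (1 + E) + 1 ≤ c / K * (M : ℝ≥0) ^ α ∧ 1 ≤ M := by
    have ht : Filter.Tendsto (fun M : ℕ => (c / K : ℝ) * (M : ℝ) ^ α) Filter.atTop Filter.atTop :=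
      ((tendsto_rpow_atTop hα).comp tendsto_natCast_atTop_atTop).const_mul_atTop
        (by exact_mod_cast hcK)
    obtain ⟨M, hM, hM1⟩ := ((ht.eventually_ge_atTop ((C * (1 + E) + 1 : ℝ≥0) : ℝ)).and
      (Filter.eventually_ge_atTop 1)).exists
    refine ⟨M, ?_, hM1⟩
    rw [← NNReal.coe_le_coe]
    simpa using hM
  refine ⟨M, hM1, C * ((1 + E) + E * ((M + 1 : ℕ) : ℝ≥0) ^ α : ℝ≥0), by positivity,
    fun A B hAB hA hB => ?_⟩
  set n := A.card with hn
  have hn1 : 1 ≤ n := hA.card_pos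
  set x := ∑ k ∈ A ∪ B, b k with hx
  set u := ‖∑ k ∈ A, b k‖₊ with hu
  set v := ‖∑ k ∈ B, b k‖₊ with hv
  have hxuv : ‖x‖ₑ ≤ ((u + v : ℝ≥0) : ℝ≥0∞) := by
    rw [enorm_eq_nnnorm, ENNReal.coe_le_coe, hx, sum_union hAB]
    exact nnnorm_add_le _ _
  have hbest : rateNorm α q (bestError b x) ≤
      E * ((n : ℝ≥0∞) ^ α * (u + v : ℝ≥0) + (((M + 1) * n : ℕ) : ℝ≥0∞) ^ α * v) := by
    refine hE _ _ _ _ _ (fun k _ => ?_) (fun k hk => bestError_sum_union_le b hAB hk.le)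
      fun k hk => ?_
    · refine le_trans ?_ hxuv
      simpa using bestError_le b x (S := ∅) (Nat.zero_le k) 0
    · have hcard : (A ∪ B).card ≤ k := by
        rw [card_union_of_disjoint hAB, hB, ← hn]
        linarith
      have := bestError_le b x hcard fun _ => 1
      simpa [← hx] using this
  have hgreedy : c * (((M * n : ℕ) : ℝ≥0∞) ^ α * (u / K : ℝ≥0)) ≤
      rateNorm α q (greedyError b x) := by
    refine hc' _ _ _ (Nat.mul_pos hM1 hn1) fun k hk => ?_
    have hle := norm_sum_le_mul_greedyError b hAB (hk.trans_eq hB.symm)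
    rw [ENNReal.coe_div hK.ne']
    refine ENNReal.div_le_of_le_mul ?_
    rwa [mul_comm]
  have hmain : c * (((M * n : ℕ) : ℝ≥0∞) ^ α * (u / K : ℝ≥0)) ≤ C * (((u + v : ℝ≥0) : ℝ≥0∞) +
      E * ((n : ℝ≥0∞) ^ α * (u + v : ℝ≥0) + (((M + 1) * n : ℕ) : ℝ≥0∞) ^ α * v)) := by
    have happrox : approxNorm b α q x ≤ ((u + v : ℝ≥0) : ℝ≥0∞) +
        E * ((n : ℝ≥0∞) ^ α * (u + v : ℝ≥0) + (((M + 1) * n : ℕ) : ℝ≥0∞) ^ α * v) :=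
      add_le_add hxuv hbest
    -- Optimality applies only inside the approximation space; the bound just found is finite.
    have hmem : x ∈ approxSpace b α q := by
      refine happrox.trans_lt ?_
      simp only [natCast_rpow_eq_coe hα.le, ← ENNReal.coe_mul, ← ENNReal.coe_add]
      exact ENNReal.coe_lt_top
    calc _ ≤ greedyNorm b α q x := hgreedy.trans le_add_self
      _ ≤ C * approxNorm b α q x := hC x hmem
      _ ≤ _ := by gcongr
  simp only [natCast_rpow_eq_coe hα.le, ← ENNReal.coe_mul, ← ENNReal.coe_add,
    ENNReal.coe_le_coe] at hmain
  simp only [Nat.cast_mul, NNReal.mul_rpow] at hmain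
  set a := (n : ℝ≥0) ^ α with ha
  have ha1 : 1 ≤ a := NNReal.one_le_rpow (by exact_mod_cast hn1) hα.le
  set p := ((M + 1 : ℕ) : ℝ≥0) ^ α
  -- The term `u + v` coming from `‖x‖` lacks the factor `a = n^α`; since `1 ≤ a` it can be
  -- supplied, and `a` then cancels.
  have hscaled : a * ((C * (1 + E) + 1) * u) ≤ a * (C * (1 + E) * u + C * (1 + E + E * p) * v) := by
    calc a * ((C * (1 + E) + 1) * u) ≤ a * (c / K * (M : ℝ≥0) ^ α * u) := by gcongr
      _ = c * ((M : ℝ≥0) ^ α * a * (u / K)) := by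
        simp only [div_eq_mul_inv]; ring
      _ ≤ C * (u + v + E * (a * (u + v) + p * a * v)) := hmain
      _ ≤ C * (a * (u + v) + E * (a * (u + v) + p * a * v)) := by
        gcongr
        exact le_mul_of_one_le_left zero_le ha1
      _ = _ := by ring
  have hfinal := le_of_mul_le_mul_left hscaled (one_pos.trans_le ha1)
  have hfinal' : u ≤ C * (1 + E + E * p) * v := by
    rw [add_mul, one_mul] at hfinal
    exact le_of_add_le_add_left hfinal
  exact_mod_cast hfinal'

/-- Cutting `A` into at most `4 * M` pieces `T` of size at most `#A / (2 * M)` leaves room in `B \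
T` for a set `M` times as large as `T`, which provides both disjointness and the length ratio. -/
theorem IsOptimal.isDemocratic {b : UnconditionalSchauderBasis ℕ 𝕜 X}
    (hb : ∀ n, ‖b n‖ = 1) {α : ℝ} (hα : 0 < α) {q : ℝ≥0∞} (hq : 0 < q) (h : IsOptimal b α q) :
    IsDemocratic b := by
  obtain ⟨M, hM1, D, hD, hMD⟩ := h.exists_norm_sum_le hb hα hq
  set K : ℝ := (b.nnnormProjBound : ℝ) with hK
  have hK0 : 0 ≤ K := NNReal.coe_nonneg _
  -- In `1 + D`, the 1 serves sets with fewer than `2 * M` elements, split into singletons, and `D`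
  -- serves the rest.
  refine ⟨(4 * M : ℕ) * ((1 + D) * K), fun A B hAB => ?_⟩
  rcases A.eq_empty_or_nonempty with rfl | hA
  · simpa using by positivity
  have hB : B.Nonempty := by rw [← card_pos, ← hAB]; exact hA.card_pos
  have hA1 : 1 ≤ A.card := hA.card_pos
  rw [mul_assoc]
  rcases lt_or_ge A.card (2 * M) with hsmall | hlarge
  · refine norm_sum_le_mul_of_card_le (n := 1) (fun T _ hT => ?_) (by omega)
    have h1 : ‖∑ i ∈ T, b i‖ ≤ 1 := by
      refine (norm_sum_le_of_le T fun i _ => (hb i).le).trans ?_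
      simpa using hT
    have h2 := one_le_nnnormProjBound_mul b hb hB
    rw [← hK] at h2
    nlinarith
  · set n := A.card / (2 * M) with hn
    have hn1 : 1 ≤ n := (Nat.one_le_div_iff (by omega)).2 hlarge
    have hnle : 2 * M * n ≤ A.card := Nat.mul_div_le _ _
    have hnlt : A.card < 2 * M * (n + 1) := Nat.lt_mul_div_succ _ (by omega)
    have hcover : A.card ≤ 4 * M * n := by nlinarith
    refine norm_sum_le_mul_of_card_le (n := n) (fun T _ hT => ?_) hcover
    rcases T.eq_empty_or_nonempty with rfl | hTne
    · simpa using by positivity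
    have hroom : M * T.card ≤ (B \ T).card := by
      have h1 : B.card - T.card ≤ (B \ T).card := le_card_sdiff T B
      have h2 : M * T.card ≤ M * n := Nat.mul_le_mul_left M hT
      have h3 : n ≤ M * n := Nat.le_mul_of_pos_left n hM1
      have h4 : 2 * M * n = M * n + M * n := by ring
      omega
    obtain ⟨S, hSB, hS⟩ := exists_subset_card_eq hroom
    have h1 := hMD T S (disjoint_sdiff.mono_right hSB) hTne hS
    have h2 := norm_sum_le_of_subset b (hSB.trans sdiff_subset)
    calc ‖∑ i ∈ T, b i‖ ≤ D * (K * ‖∑ i ∈ B, b i‖) := h1.trans (by gcongr)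
      _ ≤ (1 + D) * K * ‖∑ i ∈ B, b i‖ := by
        rw [mul_assoc]
        gcongr
        linarith

end Optimality

end GreedyBasis

theorem theorem2 {𝕜 X : Type*} [RCLike 𝕜] [NormedAddCommGroup X] [NormedSpace 𝕜 X]
    [CompleteSpace X] (b : UnconditionalSchauderBasis ℕ 𝕜 X) (hb : ∀ n, ‖b n‖ = 1) :
    List.TFAE [
      GreedyBasis.IsDemocratic b,
      GreedyBasis.IsGreedy b,
      ∀ (α : ℝ) (q : ℝ≥0∞), 0 < α → 0 < q → GreedyBasis.IsOptimal b α q,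
      ∃ (α : ℝ) (q : ℝ≥0∞), 0 < α ∧ 0 < q ∧ GreedyBasis.IsOptimal b α q] := by
  tfae_have 1 → 2 := fun h => h.isGreedy
  tfae_have 2 → 3 := fun h α q _ hq => h.isOptimal α hq
  tfae_have 3 → 4 := fun h => ⟨1, 1, one_pos, one_pos, h 1 1 one_pos one_pos⟩
  tfae_have 4 → 1 := fun ⟨_, _, hα, hq, h⟩ => h.isDemocratic hb hα hq
  tfae_finish
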